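/- Let $M$ be a smooth $n$-dimensional manifold, let $g,\hat g$ be smooth Riemannian metrics on $M$ and let $B,\hat B$ be smooth fields of endomorphisms of $TM$, related by \[ \hat g(X,Y)=g\big((\mathrm{Id}+B)X,(\mathrm{Id}+B)Y\big),\qquad \hat B=(\mathrm{Id}+B)^{-1}(\mathrm{Id}-B), \] where $-1$ is not an eigenvalue of $B$ or of $\hat B$ at any point of $M$. Let $\nabla,\widehat\nabla$ be the Levi-Civita connections of $g,\hat g$, and put $I\!I(X,Y)=g(BX,Y)$, $\widehat{I\!I}(X,Y)=\hat g(\hat BX,Y)$. Write $R(X,Y)Z=\nabla_X\nabla_YZ-\nabla_Y\nabla_XZ-\nabla_{[X,Y]}Z$, $Rm(X,Y,Z,W)=g(R(X,Y)Z,W)$, $d^{\nabla}B(X,Y)=\nabla_X(BY)-\nabla_Y(BX)-B[X,Y]$, and likewise $\widehat{Rm}$ and $d^{\widehat\nabla}\hat B$ for $(\hat g,\hat B)$; for bilinear forms $T,S$ let \[ (T\odot S)(X,Y,Z,W)=T(X,W)S(Y,Z)+T(Y,Z)S(X,W)-T(X,Z)S(Y,W)-T(Y,W)S(X,Z) \]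 be their Kulkarni–Nomizu product. Then $(g,B)$ solves the Gauss–Codazzi equations of hyperbolic space, \[ Rm=-\tfrac12\, g\odot g+\tfrac12\, I\!I\odot I\!I,\qquad d^{\nabla}B=0, \] if and only if $(\hat g,\hat B)$ solves the Gauss–Codazzi equations at infinity, \[ \widehat{Rm}=-\tfrac12\,\hat g\odot\widehat{I\!I},\qquad d^{\widehat\nabla}\hat B=0 . \] -/

import Mathlib

open Bundle VectorField FiberBundle
open scoped Manifold ContDiff

noncomputable section

namespace GaussCodazzi

variable {n : ℕ} {M : Type*} [TopologicalSpace M] [ChartedSpace (EuclideanSpace ℝ (Fin n)) M]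
  [IsManifold (𝓡 n) ∞ M]

variable (n M) in
/-- Smooth Riemannian metrics on the `n`-dimensional manifold `M`. -/
abbrev Metric :=
  ContMDiffRiemannianMetric (𝓡 n) ∞ (EuclideanSpace ℝ (Fin n)) (TangentSpace (𝓡 n) : M → Type)

variable (n M) in
/-- Smooth `(1,1)`-tensors on `M`, i.e. smooth sections of the bundle `End(TM)`. -/
abbrev EndField :=
  ContMDiffSection (𝓡 n) (EuclideanSpace ℝ (Fin n) →L[ℝ] EuclideanSpace ℝ (Fin n)) ∞
    (fun x : M ↦ TangentSpace (𝓡 n) x →L[ℝ] TangentSpace (𝓡 n) x)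

variable (n M) in
/-- Vector fields on `M`; smoothness is required separately. -/
abbrev VField := Π x : M, TangentSpace (𝓡 n) x

/-- The vector field `X` is smooth at `x`. -/
def VField.SmoothAt (X : VField n M) (x : M) : Prop :=
  ContMDiffAt (𝓡 n) (𝓡 n).tangent ∞ (fun y ↦ (⟨y, X y⟩ : TangentBundle (𝓡 n) M)) x

variable (n M) in
/-- Connections on the tangent bundle. The field that is differentiated comes first:
`∇_X Y` at `x` is `D Y x (X x)`. -/
abbrev Connection :=
  CovariantDerivative (𝓡 n) (EuclideanSpace ℝ (Fin n)) (TangentSpace (𝓡 n) : M → Type)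

/-- The vector field `∇_X Y`. -/
def Connection.nabla (D : Connection n M) (X Y : VField n M) : VField n M :=
  fun x ↦ D Y x (X x)

/-- `D` is compatible with the metric `g`: `X g(Y, Z) = g(∇_X Y, Z) + g(Y, ∇_X Z)` for all
differentiable fields `X`, `Y`, `Z`. -/
def IsCompatible (g : Metric n M) (D : Connection n M) : Prop :=
  letI : RiemannianBundle (TangentSpace (𝓡 n) : M → Type) := ⟨g.toRiemannianMetric⟩
  D.IsMetricCompatible

/-- `D` is a Levi-Civita connection of `g`: torsion free and compatible with `g`. Existence and
uniqueness (on differentiable fields) are proved below. -/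
structure IsLeviCivita (g : Metric n M) (D : Connection n M) : Prop where
  torsion_eq_zero : D.torsion = 0
  compatible : IsCompatible g D

/-- The vector field `X` is differentiable at `x`. -/
abbrev VField.DiffAt (X : VField n M) (x : M) : Prop :=
  MDifferentiableAt (𝓡 n) (𝓡 n).tangent (fun y ↦ (⟨y, X y⟩ : TangentBundle (𝓡 n) M)) x

theorem isCompatible_iff (g : Metric n M) (D : Connection n M) :
    IsCompatible g D ↔ ∀ (x : M) (X Y Z : VField n M), X.DiffAt x → Y.DiffAt x → Z.DiffAt x →
      mvfderiv (𝓡 n) (fun y ↦ g.inner y (Y y) (Z y)) x (X x) =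
        g.inner x (D.nabla X Y x) (Z x) + g.inner x (Y x) (D.nabla X Z x) := by
  let _ : RiemannianBundle (TangentSpace (𝓡 n) : M → Type) := ⟨g.toRiemannianMetric⟩
  unfold IsCompatible
  rw [CovariantDerivative.isMetricCompatible_iff]
  exact ⟨fun h x X Y Z hX hY hZ ↦ h hX hY hZ, fun h x X Y Z hX hY hZ ↦ h x X Y Z hX hY hZ⟩

section Koszul

variable (g : Metric n M) {x : M}

theorem mdiffAt_inner {Y Z : VField n M} (hY : Y.DiffAt x) (hZ : Z.DiffAt x) :
    MDifferentiableAt (𝓡 n) 𝓘(ℝ, ℝ) (fun y ↦ g.inner y (Y y) (Z y)) x := by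
  let _ : RiemannianBundle (TangentSpace (𝓡 n) : M → Type) := ⟨g.toRiemannianMetric⟩
  exact MDifferentiableAt.inner_bundle (IB := 𝓡 n) (F := EuclideanSpace ℝ (Fin n))
    (E := (TangentSpace (𝓡 n) : M → Type)) hY hZ

/-- The derivative of the function `g(Y,Z)` in the direction of `X`. -/
def dInner (X Y Z : VField n M) (x : M) : ℝ :=
  mvfderiv (𝓡 n) (fun y ↦ g.inner y (Y y) (Z y)) x (X x)

theorem dInner_comm (X Y Z : VField n M) : dInner g X Y Z x = dInner g X Z Y x := by
  unfold dInner
  congr 2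
  ext y
  exact g.symm y _ _

theorem dInner_add {Y Y' Z : VField n M} (X : VField n M) (hY : Y.DiffAt x) (hY' : Y'.DiffAt x)
    (hZ : Z.DiffAt x) : dInner g X (Y + Y') Z x = dInner g X Y Z x + dInner g X Y' Z x := by
  have := mvfderiv_add (mdiffAt_inner g hY hZ) (mdiffAt_inner g hY' hZ)
  unfold dInner
  rw [← add_apply, ← this]
  congr 2
  ext y
  simp

theorem dInner_smul {Y Z : VField n M} {f : M → ℝ} (X : VField n M)
    (hf : MDifferentiableAt (𝓡 n) 𝓘(ℝ, ℝ) f x) (hY : Y.DiffAt x) (hZ : Z.DiffAt x) :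
    dInner g X (f • Y) Z x =
      f x * dInner g X Y Z x + mvfderiv (𝓡 n) f x (X x) * g.inner x (Y x) (Z x) := by
  have := mvfderiv_mul hf (mdiffAt_inner g hY hZ)
  unfold dInner
  have h2 : (fun y ↦ g.inner y ((f • Y) y) (Z y)) = f * fun y ↦ g.inner y (Y y) (Z y) := by
    ext y
    simp
  rw [h2, this]
  simp
  ring

/-- The Koszul expression, which is twice `g(∇_X Y, Z)`. -/
def koszul (Y X Z : VField n M) (x : M) : ℝ :=
  dInner g X Y Z x + dInner g Y X Z x - dInner g Z X Y x
    + g.inner x (mlieBracket (𝓡 n) X Y x) (Z x) - g.inner x (mlieBracket (𝓡 n) X Z x) (Y x)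
    - g.inner x (mlieBracket (𝓡 n) Y Z x) (X x)

theorem koszul_tensorial₁ {Y Z : VField n M} (hY : Y.DiffAt x) (hZ : Z.DiffAt x) :
    TensorialAt (𝓡 n) (EuclideanSpace ℝ (Fin n)) (fun X : VField n M ↦ koszul g Y X Z x) x where
  smul {f X} hf hX := by
    simp only [koszul, dInner_smul g _ hf hX hZ, dInner_smul g _ hf hX hY,
      mlieBracket_smul_left hf hX]
    simp [dInner]
    ring
  add {X X'} hX hX' := by
    simp only [koszul, dInner_add g _ hX hX' hZ, dInner_add g _ hX hX' hY,
      mlieBracket_add_left hX hX']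
    simp [dInner]
    ring

theorem koszul_tensorial₂ {Y X : VField n M} (hY : Y.DiffAt x) (hX : X.DiffAt x) :
    TensorialAt (𝓡 n) (EuclideanSpace ℝ (Fin n)) (fun Z : VField n M ↦ koszul g Y X Z x) x where
  smul {f Z} hf hZ := by
    simp only [koszul, dInner_comm g _ _ (f • Z), dInner_smul g _ hf hZ hX,
      dInner_smul g _ hf hZ hY, mlieBracket_smul_right hf hZ, dInner_comm g _ Z]
    simp [dInner, g.symm x (Z x)]
    ring
  add {Z Z'} hZ hZ' := by
    simp only [koszul, dInner_comm g _ _ (Z + Z'), dInner_add g _ hZ hZ' hX,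
      dInner_add g _ hZ hZ' hY, mlieBracket_add_right hZ hZ', dInner_comm g _ Z,
      dInner_comm g _ Z']
    simp [dInner]
    ring

theorem inner_ext {v w : TangentSpace (𝓡 n) x} (h : ∀ u, g.inner x v u = g.inner x w u) :
    v = w := by
  by_contra hne
  have := g.pos x (v - w) (sub_ne_zero.2 hne)
  have h0 : g.inner x (v - w) (v - w) = 0 := by
    rw [(g.inner x).map_sub, sub_apply, h, sub_self]
  exact this.ne' h0

theorem exists_koszul {Y : VField n M} (hY : Y.DiffAt x) :
    ∃ L : TangentSpace (𝓡 n) x →L[ℝ] TangentSpace (𝓡 n) x, ∀ X Z : VField n M,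
      X.DiffAt x → Z.DiffAt x → 2 * g.inner x (L (X x)) (Z x) = koszul g Y X Z x := by
  let K := TensorialAt.mkHom₂ (fun X Z : VField n M ↦ koszul g Y X Z x) x
    (fun Z hZ ↦ koszul_tensorial₁ g hY hZ) (fun X hX ↦ koszul_tensorial₂ g hY hX)
  have : FiniteDimensional ℝ (TangentSpace (𝓡 n) x) :=
    inferInstanceAs (FiniteDimensional ℝ (EuclideanSpace ℝ (Fin n)))
  have : T2Space (TangentSpace (𝓡 n) x) := inferInstanceAs (T2Space (EuclideanSpace ℝ (Fin n)))
  let G : TangentSpace (𝓡 n) x →ₗ[ℝ] Module.Dual ℝ (TangentSpace (𝓡 n) x) :=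
    ContinuousLinearMap.coeLM ℝ ∘ₗ (g.inner x).toLinearMap
  have hG : Function.Injective G := fun v w h ↦ inner_ext g fun u ↦ congr($h u)
  have hG' : Function.Surjective G :=
    (LinearMap.injective_iff_surjective_of_finrank_eq_finrank
      (Subspace.dual_finrank_eq (K := ℝ)).symm).1 hG
  obtain ⟨S, hS⟩ := LinearMap.exists_rightInverse_of_surjective G (LinearMap.range_eq_top.2 hG')
  let L : TangentSpace (𝓡 n) x →ₗ[ℝ] TangentSpace (𝓡 n) x :=
    (2⁻¹ : ℝ) • (S ∘ₗ ContinuousLinearMap.coeLM ℝ ∘ₗ K.toLinearMap)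
  refine ⟨LinearMap.toContinuousLinearMap L, fun X Z hX hZ ↦ ?_⟩
  have h1 : G (S (ContinuousLinearMap.coeLM ℝ (K (X x)))) = ContinuousLinearMap.coeLM ℝ (K (X x)) :=
    congr($hS _)
  have h2 : g.inner x (S (ContinuousLinearMap.coeLM ℝ (K (X x)))) (Z x) = K (X x) (Z x) :=
    congr($h1 (Z x))
  have h3 : K (X x) (Z x) = koszul g Y X Z x := TensorialAt.mkHom₂_apply _ _ hX hZ
  rw [← h3, ← h2]
  simp [L]

end Koszul

theorem diffAt_extend {x : M} (v : TangentSpace (𝓡 n) x) :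
    VField.DiffAt (extend (EuclideanSpace ℝ (Fin n)) v : VField n M) x :=
  mdifferentiableAt_extend ..

open Classical in
/-- The Koszul connection of `g`. -/
def koszulFun (g : Metric n M) (Y : VField n M) (x : M) :
    TangentSpace (𝓡 n) x →L[ℝ] TangentSpace (𝓡 n) x :=
  if h : Y.DiffAt x then (exists_koszul g h).choose else 0

theorem koszulFun_spec (g : Metric n M) {x : M} {X Y Z : VField n M} (hX : X.DiffAt x)
    (hY : Y.DiffAt x) (hZ : Z.DiffAt x) :
    2 * g.inner x (koszulFun g Y x (X x)) (Z x) = koszul g Y X Z x := by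
  rw [koszulFun, dif_pos hY]
  exact (exists_koszul g hY).choose_spec X Z hX hZ

theorem hom_ext (g : Metric n M) {x : M} {L L' : TangentSpace (𝓡 n) x →L[ℝ] TangentSpace (𝓡 n) x}
    (h : ∀ X Z : VField n M, X.DiffAt x → Z.DiffAt x →
      2 * g.inner x (L (X x)) (Z x) = 2 * g.inner x (L' (X x)) (Z x)) : L = L' := by
  ext1 v
  refine inner_ext g fun u ↦ ?_
  have := h _ _ (diffAt_extend v) (diffAt_extend u)
  simpa using this

/-- Every metric has a Levi-Civita connection. -/
theorem exists_isLeviCivita (g : Metric n M) : ∃ D : Connection n M, IsLeviCivita g D := by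
  refine ⟨⟨koszulFun g, ⟨?_, ?_⟩⟩, ?_, ?_⟩
  · intro Y Y' x hY hY' _
    refine hom_ext g fun X Z hX hZ ↦ ?_
    have hs : VField.DiffAt (Y + Y' : VField n M) x := mdifferentiableAt_add_section hY hY'
    rw [add_apply, map_add, add_apply, mul_add,
      koszulFun_spec g hX hY hZ, koszulFun_spec g hX hY' hZ, koszulFun_spec g hX hs hZ]
    simp only [koszul, dInner_add g _ hY hY' hZ, dInner_comm g _ X (Y + Y'),
      dInner_add g _ hY hY' hX, mlieBracket_add_left hY hY', mlieBracket_add_right hY hY',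
      dInner_comm g _ X Y, dInner_comm g _ X Y']
    simp [dInner]
    ring
  · intro Y f x hY hf _
    refine hom_ext g fun X Z hX hZ ↦ ?_
    have hs : VField.DiffAt (f • Y : VField n M) x := hf.smul_section hY
    have h0 := koszulFun_spec g hX hY hZ
    rw [koszulFun_spec g hX hs hZ]
    have h1 : 2 * g.inner x ((f x • koszulFun g Y x +
        (mvfderiv (𝓡 n) f x).smulRight (Y x)) (X x)) (Z x) =
        f x * koszul g Y X Z x + 2 * (mvfderiv (𝓡 n) f x (X x) * g.inner x (Y x) (Z x)) := by
      rw [← h0]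
      simp
      ring
    refine Eq.trans ?_ h1.symm
    simp only [koszul, dInner_smul g _ hf hY hZ, dInner_comm g _ X (f • Y),
      dInner_smul g _ hf hY hX, mlieBracket_smul_left hf hY, mlieBracket_smul_right hf hY,
      dInner_comm g _ X Y]
    simp [dInner]
    ring
  · rw [CovariantDerivative.torsion_eq_zero_iff]
    intro X Y x hX hY
    refine inner_ext g fun u ↦ ?_
    have hu := diffAt_extend u
    have h1 := koszulFun_spec g hX hY hu
    have h2 := koszulFun_spec g hY hX hu
    simp only [extend_apply_self] at h1 h2
    have h3 := mlieBracket_swap_apply (I := 𝓡 n) (V := Y) (W := X) (x := x)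
    simp only [koszul, h3, extend_apply_self] at h1 h2
    rw [dInner_comm g _ Y X] at h2
    simp at h1 h2 ⊢
    linarith
  · rw [isCompatible_iff]
    intro x X Y Z hX hY hZ
    have h1 := koszulFun_spec g hX hY hZ
    have h2 := koszulFun_spec g hX hZ hY
    have h3 := mlieBracket_swap_apply (I := 𝓡 n) (V := Z) (W := Y) (x := x)
    simp only [koszul, h3] at h1 h2
    rw [dInner_comm g _ Z Y] at h2
    have h4 := g.symm x (Y x) (koszulFun g Z x (X x))
    simp only [map_neg, neg_apply] at h1 h2
    have h5 : dInner g X Y Z x = g.inner x (koszulFun g Y x (X x)) (Z x) +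
        g.inner x (Y x) (koszulFun g Z x (X x)) := by
      rw [h4]
      linarith
    exact h5

theorem IsLeviCivita.two_mul_inner {g : Metric n M} {D : Connection n M} (h : IsLeviCivita g D)
    {x : M} {X Y Z : VField n M} (hX : X.DiffAt x) (hY : Y.DiffAt x) (hZ : Z.DiffAt x) :
    2 * g.inner x (D Y x (X x)) (Z x) = koszul g Y X Z x := by
  have hc := (isCompatible_iff g D).1 h.compatible x
  have ht : ∀ {X Y : VField n M}, X.DiffAt x → Y.DiffAt x →
      D Y x (X x) - D X x (Y x) = mlieBracket (𝓡 n) X Y x :=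
    fun hX hY ↦ (CovariantDerivative.torsion_eq_zero_iff D).1 h.torsion_eq_zero hX hY
  have h1 := hc X Y Z hX hY hZ
  have h2 := hc Y X Z hY hX hZ
  have h3 := hc Z X Y hZ hX hY
  simp only [Connection.nabla] at h1 h2 h3
  simp only [koszul, dInner, h1, h2, h3, ← ht hX hY, ← ht hX hZ, ← ht hY hZ]
  simp only [map_sub, sub_apply]
  rw [g.symm x (Y x), g.symm x (X x), g.symm x (X x)]
  ring

/-- Two Levi-Civita connections of `g` agree on every field, wherever it is differentiable. -/
theorem IsLeviCivita.unique {g : Metric n M} {D D' : Connection n M} (h : IsLeviCivita g D)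
    (h' : IsLeviCivita g D') {x : M} {Y : VField n M} (hY : Y.DiffAt x) : D Y x = D' Y x :=
  hom_ext g fun X Z hX hZ ↦ by rw [h.two_mul_inner hX hY hZ, h'.two_mul_inner hX hY hZ]

/-- `R(X,Y)Z = ∇_X ∇_Y Z - ∇_Y ∇_X Z - ∇_{[X,Y]} Z`. -/
def curvature (D : Connection n M) (X Y Z : VField n M) : VField n M :=
  D.nabla X (D.nabla Y Z) - D.nabla Y (D.nabla X Z) - D.nabla (mlieBracket (𝓡 n) X Y) Z

/-- `Rm(X,Y,Z,W) = g(R(X,Y)Z, W)`. -/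
def Rm (g : Metric n M) (D : Connection n M) (X Y Z W : VField n M) (x : M) : ℝ :=
  g.inner x (curvature D X Y Z x) (W x)

/-- The vector field `B X`. -/
def applyEnd (B : EndField n M) (X : VField n M) : VField n M := fun x ↦ B x (X x)

/-- The exterior covariant derivative
`d^∇ B (X,Y) = ∇_X (B Y) - ∇_Y (B X) - B [X,Y]`. -/
def extCovDeriv (D : Connection n M) (B : EndField n M) (X Y : VField n M) : VField n M :=
  D.nabla X (applyEnd B Y) - D.nabla Y (applyEnd B X) - applyEnd B (mlieBracket (𝓡 n) X Y)

/-- The second fundamental form `II(v,w) = g(Bv,w)` at `x`. -/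
def secondFF (g : Metric n M) (B : EndField n M) (x : M) :
    TangentSpace (𝓡 n) x →L[ℝ] TangentSpace (𝓡 n) x →L[ℝ] ℝ :=
  (g.inner x).comp (B x)

/-- The Kulkarni-Nomizu product of two bilinear forms. -/
def kulkarniNomizu {V : Type*} [AddCommGroup V] [Module ℝ V] [TopologicalSpace V]
    (T S : V →L[ℝ] V →L[ℝ] ℝ) (X Y Z W : V) : ℝ :=
  T X W * S Y Z + T Y Z * S X W - T X Z * S Y W - T Y W * S X Z

/-- `(g, B)` solves the Gauss-Codazzi equations of hyperbolic space:
`Rm = -(1/2) g ⊙ g + (1/2) II ⊙ II` and `d^∇ B = 0`, where `∇` is the Levi-Civita connection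
of `g`. Both are equations between tensors, so they are tested at each point `x` on vector fields
that are smooth near `x`. -/
def SolvesGaussCodazzi (g : Metric n M) (B : EndField n M) : Prop :=
  ∃ D : Connection n M, IsLeviCivita g D ∧
    (∀ (x : M) (X Y Z W : VField n M),
      X.SmoothAt x → Y.SmoothAt x → Z.SmoothAt x → W.SmoothAt x →
      Rm g D X Y Z W x =
        -(1 / 2) * kulkarniNomizu (g.inner x) (g.inner x) (X x) (Y x) (Z x) (W x) +
        (1 / 2) * kulkarniNomizu (secondFF g B x) (secondFF g B x) (X x) (Y x) (Z x) (W x)) ∧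
    (∀ (x : M) (X Y : VField n M),
      X.SmoothAt x → Y.SmoothAt x → extCovDeriv D B X Y x = 0)

/-- `(g, B)` solves the Gauss-Codazzi equations at infinity:
`Rm = -(1/2) g ⊙ II` and `d^∇ B = 0`, where `∇` is the Levi-Civita connection of `g`. -/
def SolvesGaussCodazziAtInfinity (g : Metric n M) (B : EndField n M) : Prop :=
  ∃ D : Connection n M, IsLeviCivita g D ∧
    (∀ (x : M) (X Y Z W : VField n M),
      X.SmoothAt x → Y.SmoothAt x → Z.SmoothAt x → W.SmoothAt x →
      Rm g D X Y Z W x =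
        -(1 / 2) * kulkarniNomizu (g.inner x) (secondFF g B x) (X x) (Y x) (Z x) (W x)) ∧
    (∀ (x : M) (X Y : VField n M),
      X.SmoothAt x → Y.SmoothAt x → extCovDeriv D B X Y x = 0)

end GaussCodazzi

end

namespace GaussCodazzi

/-! Put P = Id + B, so that ĝ = g(P·, P·) and P B̂ = Id - B. The connection P⁻¹∇P is always
compatible with ĝ. Since ∇ is torsion free, the torsion of P⁻¹∇P is P⁻¹ d^∇B, so the Codazzi
equation makes it the Levi-Civita connection of ĝ (`IsLeviCivita.conjConnection`). Conjugation then
gives R̂ = P⁻¹RP, hence R̂m(X,Y,Z,W) = Rm(X,Y,PZ,PW) (`Rm_conjConnection`), and d^∇̂B̂ = P⁻¹ d^∇(Id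
- B) = 0 (`extCovDeriv_conjConnection`).

The Gauss equations match by a difference of squares: with a(v,w) = g(v,Pw) and b(v,w) = g(Bv,Pw)
one has ĝ = a + b and ÎI = a - b, while (a + b) ⊙ (a - b) = a ⊙ a - b ⊙ b (`kulkarniNomizu_gauss`).

For the converse, Id + B̂ = 2P⁻¹, so the pairs swap roles with P⁻¹ = ½(Id + B̂). This is why the
lemmas treat c(Id + B): c = 1 serves one direction and c = ½ the other. -/

/-- A nonzero kernel vector of 1 + b would be an eigenvector of b for -1; in finite dimension
injectivity suffices. -/
theorem isUnit_one_add {V : Type*} [AddCommGroup V] [Module ℝ V] [TopologicalSpace V]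
    [IsTopologicalAddGroup V] [ContinuousSMul ℝ V] [T2Space V] [FiniteDimensional ℝ V]
    {b : V →L[ℝ] V} (hb : ¬ Module.End.HasEigenvalue b.toLinearMap (-1)) : IsUnit (1 + b) := by
  have hinj : Function.Injective (1 + b).toLinearMap := by
    rw [← LinearMap.ker_eq_bot, LinearMap.ker_eq_bot']
    intro v hv
    by_contra hne
    refine hb (Module.End.hasEigenvalue_of_hasEigenvector
      (Module.End.hasEigenvector_iff.2 ⟨Module.End.mem_eigenspace_iff.2 ?_, hne⟩))
    have h : v + b v = 0 := hv
    rw [neg_smul, one_smul]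
    exact eq_neg_of_add_eq_zero_right h
  let e := (LinearEquiv.ofInjectiveEndo _ hinj).toContinuousLinearEquiv
  exact ⟨ContinuousLinearEquiv.unitsEquiv ℝ _ |>.symm e, by ext1 v; rfl⟩

variable {n : ℕ} {M : Type*} [TopologicalSpace M] [ChartedSpace (EuclideanSpace ℝ (Fin n)) M]
  [IsManifold (𝓡 n) ∞ M]

/-! ### Regularity of vector fields under endomorphisms -/

theorem VField.SmoothAt.diffAt {X : VField n M} {x : M} (hX : X.SmoothAt x) : X.DiffAt x :=
  ContMDiffAt.mdifferentiableAt hX (by simp)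

theorem smoothAt_extend {x : M} (v : TangentSpace (𝓡 n) x) :
    VField.SmoothAt (extend (EuclideanSpace ℝ (Fin n)) v : VField n M) x :=
  contMDiffAt_extend ..

theorem VField.DiffAt.add {X Y : VField n M} {x : M} (hX : X.DiffAt x) (hY : Y.DiffAt x) :
    VField.DiffAt (X + Y : VField n M) x :=
  mdifferentiableAt_add_section hX hY

theorem VField.DiffAt.const_smul {X : VField n M} {x : M} (c : ℝ) (hX : X.DiffAt x) :
    VField.DiffAt (c • X : VField n M) x :=
  MDifferentiableAt.smul_section (f := fun _ ↦ c) mdifferentiableAt_const hX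

theorem VField.DiffAt.applyEnd (B : EndField n M) {X : VField n M} {x : M} (hX : X.DiffAt x) :
    (applyEnd B X).DiffAt x :=
  MDifferentiableAt.clm_bundle_apply (b := id) (F₁ := EuclideanSpace ℝ (Fin n))
    (F₂ := EuclideanSpace ℝ (Fin n)) (E₁ := (TangentSpace (𝓡 n) : M → Type))
    (E₂ := (TangentSpace (𝓡 n) : M → Type))
    (B.contMDiff.contMDiffAt.mdifferentiableAt (by simp)) hX

theorem VField.SmoothAt.applyEnd (B : EndField n M) {X : VField n M} {x : M}
    (hX : X.SmoothAt x) : (applyEnd B X).SmoothAt x :=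
  ContMDiffAt.clm_bundle_apply (b := id) (F₁ := EuclideanSpace ℝ (Fin n))
    (F₂ := EuclideanSpace ℝ (Fin n)) (E₁ := (TangentSpace (𝓡 n) : M → Type))
    (E₂ := (TangentSpace (𝓡 n) : M → Type)) B.contMDiff.contMDiffAt hX

/-- The endomorphism `c (Id + B)` of the tangent space at `x`. -/
noncomputable def shift (c : ℝ) (B : EndField n M) (x : M) :
    TangentSpace (𝓡 n) x →L[ℝ] TangentSpace (𝓡 n) x :=
  c • (1 + B x)

/-- The vector field `c (X + B X)`. -/
noncomputable def shiftField (c : ℝ) (B : EndField n M) (X : VField n M) : VField n M :=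
  fun x ↦ shift c B x (X x)

theorem shiftField_eq (c : ℝ) (B : EndField n M) (X : VField n M) :
    shiftField c B X = c • (X + applyEnd B X) := by
  ext1 x
  simp [shiftField, shift, applyEnd]

theorem VField.DiffAt.shiftField (c : ℝ) (B : EndField n M) {X : VField n M} {x : M}
    (hX : X.DiffAt x) : (shiftField c B X).DiffAt x := by
  rw [shiftField_eq]
  exact (hX.add (hX.applyEnd B)).const_smul c

theorem VField.SmoothAt.shiftField (c : ℝ) (B : EndField n M) {X : VField n M} {x : M}
    (hX : X.SmoothAt x) : (shiftField c B X).SmoothAt x := by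
  rw [shiftField_eq]
  exact ContMDiffAt.const_smul_section (ContMDiffAt.add_section hX (hX.applyEnd B))

theorem Connection.map_smul_add_smul (D : Connection n M) {Y Z : VField n M} {x : M} (a b : ℝ)
    (hY : Y.DiffAt x) (hZ : Z.DiffAt x) :
    D (a • Y + b • Z) x = a • D Y x + b • D Z x := by
  have h := D.isCovariantDerivativeOn (s := Set.univ)
  rw [h.add (hY.const_smul a) (hZ.const_smul b), h.smul_const a hY, h.smul_const b hZ]

/-- The connection `Q ∘ ∇ ∘ P`, where `P = c (Id + B)` and `Q` is a left inverse of `P`. -/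
noncomputable def conjConnection (D : Connection n M) (c : ℝ) (B : EndField n M)
    (Q : Π x : M, TangentSpace (𝓡 n) x →L[ℝ] TangentSpace (𝓡 n) x)
    (hQ : ∀ x v, Q x (shift c B x v) = v) : Connection n M where
  toFun Y x := (Q x).comp (D (shiftField c B Y) x)
  isCovariantDerivativeOnUniv :=
    { add := by
        intro Y Y' x hY hY' _
        have h : shiftField c B (Y + Y') = shiftField c B Y + shiftField c B Y' := by
          ext1 x
          simp [shiftField]
        rw [h, (D.isCovariantDerivativeOn (s := Set.univ)).add
          (VField.DiffAt.shiftField c B hY) (VField.DiffAt.shiftField c B hY')]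
        ext1 v
        simp
      leibniz := by
        intro Y f x hY hf _
        have h : shiftField c B (f • Y) = f • shiftField c B Y := by
          ext1 x
          simp [shiftField]
        rw [h, (D.isCovariantDerivativeOn (s := Set.univ)).leibniz
          (VField.DiffAt.shiftField c B hY) hf]
        ext1 v
        -- In the Leibniz term df ⊗ PY, the factor Q cancels P, leaving df ⊗ Y.
        have := hQ x (Y x)
        simp [shiftField, this] }

/-! ### Curvature, Levi-Civita property and Codazzi equation under conjugation -/

section Conj

variable {g g' : Metric n M} {D : Connection n M} {c : ℝ} {B C : EndField n M}
  {Q : Π x : M, TangentSpace (𝓡 n) x →L[ℝ] TangentSpace (𝓡 n) x}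
  (hQ : ∀ x v, Q x (shift c B x v) = v)

theorem conjConnection_apply (Y : VField n M) (x : M) (v : TangentSpace (𝓡 n) x) :
    conjConnection D c B Q hQ Y x v = Q x (D (shiftField c B Y) x v) :=
  rfl

/-- In an iterated derivative Q∇P Q∇P the inner PQ cancels. -/
theorem curvature_conjConnection (hQ' : ∀ x v, shift c B x (Q x v) = v) (X Y Z : VField n M)
    (x : M) :
    curvature (conjConnection D c B Q hQ) X Y Z x =
      Q x (curvature D X Y (shiftField c B Z) x) := by
  have h (U V : VField n M) :
      shiftField c B ((conjConnection D c B Q hQ).nabla U V) =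
        D.nabla U (shiftField c B V) :=
    funext fun y ↦ hQ' y _
  simp only [curvature, Pi.sub_apply, map_sub]
  simp only [Connection.nabla, conjConnection_apply]
  simp only [← Connection.nabla.eq_1]
  rw [h, h]

theorem Rm_conjConnection (hQ' : ∀ x v, shift c B x (Q x v) = v)
    (hg : ∀ x v w, g'.inner x v w = g.inner x (shift c B x v) (shift c B x w))
    (X Y Z W : VField n M) (x : M) :
    Rm g' (conjConnection D c B Q hQ) X Y Z W x =
      Rm g D X Y (shiftField c B Z) (shiftField c B W) x := by
  rw [Rm, hg, curvature_conjConnection hQ hQ', hQ']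
  rfl

/-- For a torsion free connection, a Codazzi tensor `B` and `P = a Id + b B`, we have
`∇_X (P Y) - ∇_Y (P X) = P [X,Y]`. -/
theorem nabla_sub_nabla_of_codazzi (hD : D.torsion = 0) {X Y : VField n M} {x : M} (a b : ℝ)
    (hX : X.DiffAt x) (hY : Y.DiffAt x) (hB : extCovDeriv D B X Y x = 0) :
    D (a • Y + b • applyEnd B Y) x (X x) - D (a • X + b • applyEnd B X) x (Y x) =
      a • mlieBracket (𝓡 n) X Y x + b • B x (mlieBracket (𝓡 n) X Y x) := by
  have ht := (CovariantDerivative.torsion_eq_zero_iff D).1 hD hX hY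
  have hB' : D (applyEnd B Y) x (X x) - D (applyEnd B X) x (Y x) =
      B x (mlieBracket (𝓡 n) X Y x) := sub_eq_zero.1 hB
  rw [D.map_smul_add_smul a b hY (hY.applyEnd B), D.map_smul_add_smul a b hX (hX.applyEnd B),
    ← hB', ← ht]
  simp only [add_apply, smul_apply]
  module

/-- If `∇` is the Levi-Civita connection of `g` and `B` is a Codazzi tensor, then the conjugate of
`∇` by `P = c (Id + B)` is the Levi-Civita connection of `g(P ·, P ·)`. -/
theorem IsLeviCivita.conjConnection (h : IsLeviCivita g D)
    (hB : ∀ (x : M) (X Y : VField n M), X.SmoothAt x → Y.SmoothAt x → extCovDeriv D B X Y x = 0)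
    (hQ' : ∀ x v, shift c B x (Q x v) = v)
    (hg : ∀ x v w, g'.inner x v w = g.inner x (shift c B x v) (shift c B x w)) :
    IsLeviCivita g' (conjConnection D c B Q hQ) where
  torsion_eq_zero := by
    ext x v w
    -- Torsion is tensorial, so it can be tested on smooth extensions of v and w, where the Codazzi
    -- hypothesis applies.
    have hv := smoothAt_extend v
    have hw := smoothAt_extend w
    have := nabla_sub_nabla_of_codazzi h.torsion_eq_zero c c hv.diffAt hw.diffAt (hB x _ _ hv hw)
    rw [← smul_add, ← smul_add, ← shiftField_eq, ← shiftField_eq, ← smul_add] at this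
    rw [CovariantDerivative.torsion_apply_eq_extend, conjConnection_apply, conjConnection_apply,
      ← map_sub, this, sub_eq_zero.2]
    · rfl
    · exact hQ x _
  compatible := by
    rw [isCompatible_iff]
    intro x X Y Z hX hY hZ
    have hc := (isCompatible_iff g D).1 h.compatible x X _ _ hX (hY.shiftField c B)
      (hZ.shiftField c B)
    simp only [Connection.nabla, conjConnection_apply, hg, hQ']
    exact hc

/-- If `P = c (Id + B)` and `P C = c (Id - B)` with `B` a Codazzi tensor for `∇`, then `C` is a
Codazzi tensor for the conjugate of `∇` by `P`. -/
theorem extCovDeriv_conjConnection (hD : D.torsion = 0) {X Y : VField n M} {x : M}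
    (hX : X.DiffAt x) (hY : Y.DiffAt x) (hB : extCovDeriv D B X Y x = 0)
    (hC : ∀ x v, shift c B x (C x v) = c • (v - B x v)) :
    extCovDeriv (conjConnection D c B Q hQ) C X Y x = 0 := by
  -- PC = c Id - c B again has the form a Id + b B, now with a = c and b = -c.
  have h (Z : VField n M) : shiftField c B (applyEnd C Z) = c • Z + (-c) • applyEnd B Z := by
    ext1 y
    refine (hC y (Z y)).trans ?_
    simp only [Pi.add_apply, Pi.smul_apply, applyEnd]
    module
  have := nabla_sub_nabla_of_codazzi hD c (-c) hX hY hB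
  simp only [extCovDeriv, Pi.sub_apply, Connection.nabla, conjConnection_apply]
  rw [← map_sub, h, h, this, sub_eq_zero, applyEnd, ← hQ x (C x _), hC]
  congr 1
  module

end Conj

/-- The algebraic relation between the right hand sides of the two Gauss equations. -/
theorem kulkarniNomizu_gauss {g g' : Metric n M} {B B' : EndField n M} {x : M}
    (hg : ∀ v w, g'.inner x v w = g.inner x (shift 1 B x v) (shift 1 B x w))
    (hB : ∀ v, shift 1 B x (B' x v) = (1 : ℝ) • (v - B x v)) (X Y Z W : TangentSpace (𝓡 n) x) :
    -(1 / 2) * kulkarniNomizu (g'.inner x) (secondFF g' B' x) X Y Z W =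
      -(1 / 2) * kulkarniNomizu (g.inner x) (g.inner x) X Y (shift 1 B x Z) (shift 1 B x W) +
        (1 / 2) * kulkarniNomizu (secondFF g B x) (secondFF g B x) X Y
          (shift 1 B x Z) (shift 1 B x W) := by
  -- Only the P in the first slot is expanded; the second slot keeps Pw, matching PZ and PW on the
  -- right.
  have h1 (v w) : g'.inner x v w =
      g.inner x v (shift 1 B x w) + g.inner x (B x v) (shift 1 B x w) := by
    rw [hg, ← add_apply, ← map_add]
    simp [shift]
  have h2 (v w) : secondFF g' B' x v w =
      g.inner x v (shift 1 B x w) - g.inner x (B x v) (shift 1 B x w) := by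
    change g'.inner x (B' x v) w = _
    rw [hg, hB, one_smul, map_sub, sub_apply]
  have h3 (v w) : secondFF g B x v w = g.inner x (B x v) w := rfl
  simp only [kulkarniNomizu, h1, h2, h3]
  ring

end GaussCodazzi

/-! ### The equivalence -/

open GaussCodazzi in
theorem theorem3p2 {n : ℕ} {M : Type*} [TopologicalSpace M]
    [ChartedSpace (EuclideanSpace ℝ (Fin n)) M] [IsManifold (𝓡 n) ∞ M]
    (g g' : Metric n M) (B B' : EndField n M)
    (hg : ∀ (x : M) (v w : TangentSpace (𝓡 n) x),
      g'.inner x v w = g.inner x ((1 + B x) v) ((1 + B x) w))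
    (hB : ∀ x : M, B' x = Ring.inverse (1 + B x) * (1 - B x))
    (hev : ∀ x : M, ¬ Module.End.HasEigenvalue (B x).toLinearMap (-1))
    (hev' : ∀ x : M, ¬ Module.End.HasEigenvalue (B' x).toLinearMap (-1)) :
    SolvesGaussCodazzi g B ↔ SolvesGaussCodazziAtInfinity g' B' := by
  have hshift (x : M) : shift 1 B x = 1 + B x := one_smul ℝ _
  have hunit (x : M) : IsUnit (1 + B x) := by
    have : FiniteDimensional ℝ (TangentSpace (𝓡 n) x) :=
      inferInstanceAs (FiniteDimensional ℝ (EuclideanSpace ℝ (Fin n)))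
    have : T2Space (TangentSpace (𝓡 n) x) := inferInstanceAs (T2Space (EuclideanSpace ℝ (Fin n)))
    exact isUnit_one_add (hev x)
  have hmul (x : M) : (1 + B x) * B' x = 1 - B x := by
    rw [hB, ← mul_assoc, Ring.mul_inverse_cancel _ (hunit x), one_mul]
  -- Id = P⁻¹P and B̂ = P⁻¹(Id - B) add up to P⁻¹(2 Id), whence the factor ½.
  have hinv (x : M) : shift (1 / 2) B' x = Ring.inverse (1 + B x) := by
    have h : 1 + B' x = (2 : ℝ) • Ring.inverse (1 + B x) := by
      calc 1 + B' x = Ring.inverse (1 + B x) * ((1 + B x) + (1 - B x)) := by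
            rw [mul_add, Ring.inverse_mul_cancel _ (hunit x), hB]
        _ = Ring.inverse (1 + B x) * ((2 : ℝ) • 1) := by
            congr 1
            module
        _ = _ := by rw [mul_smul_comm, mul_one]
    rw [shift, h, smul_smul]
    norm_num
  have hQP (x : M) (v) : shift (1 / 2) B' x (shift 1 B x v) = v := by
    rw [hinv, hshift]
    exact congr($(Ring.inverse_mul_cancel _ (hunit x)) v)
  have hPQ (x : M) (v) : shift 1 B x (shift (1 / 2) B' x v) = v := by
    rw [hinv, hshift]
    exact congr($(Ring.mul_inverse_cancel _ (hunit x)) v)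
  have hC (x : M) (v) : shift 1 B x (B' x v) = (1 : ℝ) • (v - B x v) := by
    rw [hshift, one_smul]
    exact congr($(hmul x) v)
  -- Since B = P - Id, P⁻¹B = Id - P⁻¹ = Id - ½(Id + B̂) = ½(Id - B̂).
  have hC' (x : M) (v) : shift (1 / 2) B' x (B x v) = (1 / 2 : ℝ) • (v - B' x v) := by
    have h1 : B x v = shift 1 B x v - v := by simp [hshift]
    rw [h1, map_sub, hQP]
    simp only [shift, smul_apply, add_apply, one_apply_eq_self]
    module
  have hg₁ (x : M) (v w) : g'.inner x v w = g.inner x (shift 1 B x v) (shift 1 B x w) := by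
    rw [hshift]
    exact hg x v w
  have hg₂ (x : M) (v w) :
      g.inner x v w = g'.inner x (shift (1 / 2) B' x v) (shift (1 / 2) B' x w) := by
    rw [hg₁, hPQ, hPQ]
  constructor
  · rintro ⟨D, hD, hGauss, hCod⟩
    refine ⟨conjConnection D 1 B (shift (1 / 2) B') hQP, hD.conjConnection hQP hCod hPQ hg₁,
      fun x X Y Z W hX hY hZ hW ↦ ?_, fun x X Y hX hY ↦ ?_⟩
    · rw [Rm_conjConnection hQP hPQ hg₁,
        hGauss x _ _ _ _ hX hY (hZ.shiftField 1 B) (hW.shiftField 1 B)]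
      exact (kulkarniNomizu_gauss (hg₁ x) (hC x) _ _ _ _).symm
    · exact extCovDeriv_conjConnection hQP hD.torsion_eq_zero hX.diffAt hY.diffAt
        (hCod x X Y hX hY) hC
  · rintro ⟨D, hD, hGauss, hCod⟩
    refine ⟨conjConnection D (1 / 2) B' (shift 1 B) hPQ, hD.conjConnection hPQ hCod hQP hg₂,
      fun x X Y Z W hX hY hZ hW ↦ ?_, fun x X Y hX hY ↦ ?_⟩
    -- The algebraic identity is used at P⁻¹Z and P⁻¹W, so that its right side is evaluated at Z and
    -- W.
    · rw [Rm_conjConnection hPQ hQP hg₂,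
        hGauss x _ _ _ _ hX hY (hZ.shiftField (1 / 2) B') (hW.shiftField (1 / 2) B'),
        kulkarniNomizu_gauss (hg₁ x) (hC x)]
      simp only [shiftField, hPQ]
    · exact extCovDeriv_conjConnection hPQ hD.torsion_eq_zero hX.diffAt hY.diffAt
        (hCod x X Y hX hY) hC'
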